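/- Let $m\ge 1$ be an integer and let $I^m=[0,1]^m\subset\mathbb{R}^m$ be the unit cube with the metric induced by the maximum norm $\|x\|_\infty=\max_i|x_i|$. For a topological space $X$ let $\mathcal{C}(X)$ be the set of all continuous maps $X\to X$, and let $\mathcal{W}(2;X)=\{g\circ g : g\in\mathcal{C}(X)\}$. For a compact metric space $(X,d)$ equip $\mathcal{C}(X)$ with the supremum metric $\rho(f,g)=\sup_{x\in X}d(f(x),g(x))$, and write $B_\epsilon(h)$ for the open ball of radius $\epsilon$ around $h$. (a) For every $h\in\mathcal{C}(I^m)$ and every $\epsilon>0$, the ball $B_\epsilon(h)$ contains a map $f\in\mathcal{C}(I^m)$ that has no iterative square root, not even a discontinuous one: there is no map $g:I^m\to I^m$ whatsoever with $g\circ g=f$. In particular, $\mathcal{W}(2;I^m)$ contains no ball of $\mathcal{C}(I^m)$. (b) The same holds for every topological space $X$ homeomorphic to $I^m$, with $\mathcal{C}(X)$ carrying the compact-open topology: every open neighbourhood of every $h\in\mathcal{C}(X)$ contains a map $f\in\mathcal{C}(X)$ for which there is no map $g:X\to X$ with $g\circ g=f$, and $\mathcal{W}(2;X)$ contains no non-empty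 open subset of $\mathcal{C}(X)$. If $X$ is moreover a metric space (whose metric induces its topology), then for every $h\in\mathcal{C}(X)$ and $\epsilon>0$ the ball $B_\epsilon(h)$ in the supremum metric contains such an $f$, and $\mathcal{W}(2;X)$ contains no ball of $\mathcal{C}(X)$. -/

import Mathlib

/-- The unit cube `I^m` in `ℝ^m`, where `I = [0, 1]`. The ambient space `Fin m → ℝ` carries the
maximum norm, so the cube carries the metric induced by that norm. -/
def unitCube (m : ℕ) : Set (Fin m → ℝ) :=
  {x | ∀ i, x i ∈ Set.Icc (0 : ℝ) 1}

instance unitCube.instCompactSpace (m : ℕ) : CompactSpace (unitCube m) := by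
  have h : unitCube m = Set.pi Set.univ (fun _ : Fin m => Set.Icc (0 : ℝ) 1) := by
    ext x
    simp only [unitCube, Set.mem_ofPred_eq, Set.mem_pi, Set.mem_univ, true_imp_iff]
  rw [h]
  exact isCompact_iff_compactSpace.mp (isCompact_univ_pi fun _ => isCompact_Icc)

/-- The self-map `g` (not required to be continuous) is an iterative square root of `f`:
`g (g x) = f x` for all `x`. -/
def IsIterativeSquareRoot {X : Type*} (g f : X → X) : Prop :=
  g^[2] = f

/-- `W(n; X)`: the set of all `n`-th iterates of continuous self-maps of `X`, as a subset of the
space `C(X, X)` of continuous self-maps. -/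
def iterateSet (n : ℕ) (X : Type*) [TopologicalSpace X] : Set C(X, X) :=
  {f | ∃ g : C(X, X), (⇑g)^[n] = ⇑f}

/-! The obstruction is purely set-theoretic: one non-fixed point has a fibre containing infinitely
many points of the range, and every other fibre is finite. Such maps are dense. Approximate `h` by a
perturbed polynomial map `k` with finite fibres and finitely many fixed points, then precompose with
a map `φ` that collapses a small ball around a point `p = k q` to `p`. The only infinite fibre of `k
∘ φ` is the one over `k p`, and it contains infinitely many values of `k ∘ φ` near `p`. Conjugation
carries the result to homeomorphic copies of the cube. -/

/-! ### A set-theoretic obstruction to square roots -/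

theorem not_exists_iterativeSquareRoot_of_infinite_fiber {X : Type*} {f : X → X} {a : X}
    (ha : f a ≠ a) (hinf : (f ⁻¹' {a} ∩ Set.range f).Infinite)
    (hfin : ∀ x, x ≠ a → (f ⁻¹' {x}).Finite) :
    ¬ ∃ g : X → X, IsIterativeSquareRoot g f := by
  rintro ⟨g, hg⟩
  have hgg : ∀ x, g (g x) = f x := fun x => congrFun hg x
  have hcomm : ∀ x, f (g x) = g (f x) := fun x => by rw [← hgg, ← hgg]
  have hga : g a ≠ a := fun h => ha (by rw [← hgg, h, h])
  -- Pigeonhole: `g` commutes with `f`, so it maps the infinite fibre over `a` into the finite fibre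
  -- over `g a`.
  obtain ⟨z, -, hz⟩ : ∃ z ∈ f ⁻¹' {g a},
      ((f ⁻¹' {a} ∩ Set.range f) ∩ g ⁻¹' {z}).Infinite := by
    by_contra! H
    refine hinf ((Set.Finite.biUnion (hfin _ hga) fun z hz => H z hz).subset ?_)
    rintro x ⟨hx, hx'⟩
    simp only [Set.mem_preimage, Set.mem_singleton_iff] at hx
    refine Set.mem_biUnion (x := g x) ?_ ⟨⟨hx, hx'⟩, rfl⟩
    simp [hcomm, hx]
  have hgz : g z = a := by
    obtain ⟨x, ⟨hx, -⟩, hxz⟩ := hz.nonempty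
    simp only [Set.mem_preimage, Set.mem_singleton_iff] at hx hxz
    rw [← hxz, hgg, hx]
  have hza : z ≠ a := fun h => hga (by rw [h] at hgz; exact hgz)
  -- Pigeonhole again, now on preimages: if `f y` is sent to `z` by `g`, then `g y` lies in the
  -- finite fibre over `z`. This is where points of the range are needed.
  obtain ⟨w, hw, hwinf⟩ : ∃ w ∈ f ⁻¹' {z}, (g ⁻¹' {w}).Infinite := by
    by_contra! H
    refine hz (((Set.Finite.biUnion (hfin _ hza) fun w hw =>
      H w hw).image f).subset ?_)
    rintro _ ⟨⟨-, y, rfl⟩, hyz⟩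
    refine ⟨y, Set.mem_biUnion (x := g y) ?_ rfl, rfl⟩
    simpa [hcomm] using hyz
  have hgw : g w = a := by
    by_contra hne
    refine hwinf ((hfin _ hne).subset fun y hy => ?_)
    simp only [Set.mem_preimage, Set.mem_singleton_iff] at hy ⊢
    rw [← hgg, hy]
  simp only [Set.mem_preimage, Set.mem_singleton_iff] at hw
  have hgaz : g a = z := by rw [← hw, ← hgg, hgw]
  exact ha (by rw [← hgg, hgaz, hgz])

/-! ### Approximation by maps with finite fibres -/

/-- On the solution set each `x i ^ N` equals a polynomial of lower degree, so the polynomial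
functions there form a finite-dimensional algebra. Each coordinate is then integral over `k` and
takes only finitely many values. -/
theorem MvPolynomial.finite_setOf_eval_add_pow_eq_zero {σ k : Type*} [Fintype σ] [Field k]
    (Q : σ → MvPolynomial σ k) {δ : k} (hδ : δ ≠ 0) {N : ℕ} (hN : ∀ i, (Q i).totalDegree < N) :
    {x : σ → k | ∀ i, MvPolynomial.eval x (Q i) + δ * x i ^ N = 0}.Finite := by
  classical
  set F : Set (σ → k) := {x | ∀ i, MvPolynomial.eval x (Q i) + δ * x i ^ N = 0} with hF
  let ev : MvPolynomial σ k →ₐ[k] (F → k) := MvPolynomial.aeval fun i x => x.1 i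
  have hev : ∀ p x, ev p x = MvPolynomial.eval x.1 p := by
    intro p x
    induction p using MvPolynomial.induction_on with
    | C a => simp [ev]
    | add p q hp hq => simp [hp, hq]
    | mul_X p i hp => simp [hp]; simp [ev]
  have hpow : ∀ i, ev (MvPolynomial.X i ^ N) = ev (MvPolynomial.C (-δ⁻¹) * Q i) := by
    intro i
    funext x
    have := x.2 i
    simp only [hev, map_pow, map_mul, MvPolynomial.eval_X, MvPolynomial.eval_C]
    field_simp
    linear_combination this
  let W (n : ℕ) : Submodule k (F → k) :=
    (MvPolynomial.restrictTotalDegree σ k n).map ev.toLinearMap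
  have hWmem : ∀ n p, p.totalDegree ≤ n → ev p ∈ W n := fun n p hp =>
    ⟨p, (MvPolynomial.mem_restrictTotalDegree _ _ _).2 hp, rfl⟩
  -- A monomial of degree above `D` has some exponent at least `N` and can be reduced.
  let D := Fintype.card σ * N
  have hW : ∀ n, D ≤ n → ∀ p : MvPolynomial σ k, p.totalDegree ≤ n → ev p ∈ W D := by
    intro n hn
    induction n, hn using Nat.le_induction with
    | base => exact hWmem D
    | succ n hn ih =>
      intro p hp
      rw [p.as_sum, map_sum]
      refine Submodule.sum_mem _ fun e he => ?_
      have hdeg : ∑ i, e i ≤ n + 1 := by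
        have := (MvPolynomial.le_totalDegree he).trans hp
        rwa [Finsupp.sum_fintype _ _ (fun _ => rfl)] at this
      by_cases hi : ∃ i, N ≤ e i
      · obtain ⟨i, hi⟩ := hi
        have hsplit : MvPolynomial.monomial e (p.coeff e) =
            MvPolynomial.X i ^ N *
              MvPolynomial.monomial (e - Finsupp.single i N) (p.coeff e) := by
          rw [MvPolynomial.X_pow_eq_monomial, MvPolynomial.monomial_mul, one_mul,
            add_tsub_cancel_of_le]
          simpa using hi
        rw [hsplit, map_mul, hpow, ← map_mul]
        refine ih _ ((MvPolynomial.totalDegree_mul _ _).trans ?_)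
        have h1 : (MvPolynomial.C (-δ⁻¹) * Q i).totalDegree ≤ (Q i).totalDegree := by
          simpa using MvPolynomial.totalDegree_mul (MvPolynomial.C (-δ⁻¹)) (Q i)
        have h2 := MvPolynomial.totalDegree_monomial_le (e - Finsupp.single i N) (p.coeff e)
        rw [Finsupp.sum_fintype _ _ (fun _ => rfl)] at h2
        have h3 : ∑ j, (e - Finsupp.single i N) j + N = ∑ j, e j := by
          have : ∑ j, (Finsupp.single i N) j = N := by
            simp [Finsupp.single_apply]
          refine (congrArg (_ + ·) this.symm).trans ?_
          rw [← Finset.sum_add_distrib]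
          refine Finset.sum_congr rfl fun j _ => ?_
          rw [← Finsupp.add_apply, tsub_add_cancel_of_le]
          simpa using hi
        have := hN i
        simp only [id] at h2
        omega
      · push Not at hi
        refine hWmem D _ ((MvPolynomial.totalDegree_monomial_le _ _).trans ?_)
        rw [Finsupp.sum_fintype _ _ (fun _ => rfl)]
        calc ∑ i, e i ≤ ∑ _i : σ, N := Finset.sum_le_sum fun i _ => (hi i).le
          _ = D := by simp [D]
  have hfinite : FiniteDimensional k ev.range := by
    have : FiniteDimensional k (W D) := inferInstance
    refine Submodule.finiteDimensional_of_le (S₁ := Subalgebra.toSubmodule ev.range)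
      (S₂ := W D) ?_
    rintro _ ⟨p, rfl⟩
    exact hW (max D p.totalDegree) (le_max_left _ _) p (le_max_right _ _)
  have hroot : ∀ i, ∃ p : Polynomial k, p ≠ 0 ∧ ∀ x ∈ F, p.IsRoot (x i) := by
    intro i
    obtain ⟨p, hp, hp0⟩ := Algebra.IsIntegral.isIntegral (R := k)
      (⟨ev (MvPolynomial.X i), _, rfl⟩ : ev.range)
    refine ⟨p, hp.ne_zero, fun x hx => ?_⟩
    rw [← Polynomial.aeval_def] at hp0
    have h1 := congrArg (fun u : ev.range => (u : F → k) ⟨x, hx⟩) hp0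
    have h2 := Polynomial.aeval_algHom_apply
      ((Pi.evalAlgHom k (fun _ : F => k) ⟨x, hx⟩).comp ev.range.val)
      (⟨ev (MvPolynomial.X i), _, rfl⟩ : ev.range) p
    simp only [AlgHom.comp_apply, Subalgebra.val_apply, Pi.evalAlgHom_apply, hev,
      MvPolynomial.eval_X] at h2
    rw [Polynomial.IsRoot, ← Polynomial.coe_aeval_eq_eval]
    exact h2.trans h1
  choose p hp0 hp using hroot
  refine (Set.Finite.pi fun i => (p i).rootSet_finite k).subset fun x hx i _ => ?_
  rw [Polynomial.mem_rootSet]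
  exact ⟨hp0 i, by simpa using hp i x hx⟩

theorem unitCube.exists_polynomial_near {m : ℕ} (u : C(unitCube m, ℝ)) {ε : ℝ} (hε : 0 < ε) :
    ∃ P : MvPolynomial (Fin m) ℝ, ∀ x : unitCube m, |MvPolynomial.eval x.1 P - u x| < ε := by
  let coord : Fin m → C(unitCube m, ℝ) := fun i => ⟨fun x => x.1 i, (continuous_apply i).comp continuous_subtype_val⟩
  let A : Subalgebra ℝ C(unitCube m, ℝ) := (MvPolynomial.aeval (R := ℝ) coord).range
  have hA : A.SeparatesPoints := by
    intro x y hxy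
    obtain ⟨i, hi⟩ := Function.ne_iff.mp (Subtype.coe_injective.ne hxy)
    exact ⟨_, ⟨coord i, ⟨MvPolynomial.X i, by simp⟩, rfl⟩, hi⟩
  obtain ⟨⟨_, P, rfl⟩, hP⟩ :=
    ContinuousMap.exists_mem_subalgebra_near_continuousMap_of_separatesPoints A hA u ε hε
  refine ⟨P, fun x => ?_⟩
  have heval : ∀ P, MvPolynomial.eval x.1 P = MvPolynomial.aeval coord P x := by
    intro P
    induction P using MvPolynomial.induction_on with
    | C a => simp
    | add p q hp hq => simp [hp, hq]
    | mul_X p i hp => simp [hp, coord]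
  rw [heval]
  exact (ContinuousMap.norm_coe_le_norm (MvPolynomial.aeval coord P - u) x).trans_lt hP

theorem unitCube.exists_near_finite_fiber_finite_fixedPoints {m : ℕ}
    (h : C(unitCube m, unitCube m)) {ε : ℝ} (hε : 0 < ε) :
    ∃ k ∈ Metric.ball h ε, (∀ y, (k ⁻¹' {y}).Finite) ∧ (Function.fixedPoints k).Finite := by
  obtain ⟨η, hη, hη1, hηε⟩ : ∃ η : ℝ, 0 < η ∧ η ≤ 1 / 2 ∧ 2 * η < ε :=
    ⟨min (ε / 3) (1 / 2), by positivity, min_le_right _ _, by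
      have := min_le_left (ε / 3) (1 / 2); linarith⟩
  -- Shrinking `h` towards the centre leaves a margin `η` that absorbs both the polynomial error and
  -- the added power.
  have hP : ∀ i, ∃ P : MvPolynomial (Fin m) ℝ, ∀ x : unitCube m,
      |MvPolynomial.eval x.1 P - ((1 - 2 * η) * (h x).1 i + η)| < η / 2 := fun i =>
    unitCube.exists_polynomial_near
      ⟨fun x => (1 - 2 * η) * (h x).1 i + η, (continuous_const.mul ((continuous_apply i).comp
        (continuous_subtype_val.comp h.continuous))).add continuous_const⟩ (half_pos hη)
  choose P hP using hP
  -- `N` must exceed 1 as well as every degree of `P`: the right-hand sides are constants for fibres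
  -- and coordinates for fixed points.
  let N := (Finset.univ.sup fun i => (P i).totalDegree) + 2
  have hN : ∀ i, (P i).totalDegree + 2 ≤ N := fun i =>
    Nat.add_le_add_right (Finset.le_sup (f := fun i => (P i).totalDegree) (Finset.mem_univ i)) 2
  let F : (Fin m → ℝ) → Fin m → ℝ := fun x i => MvPolynomial.eval x (P i) + η / 2 * x i ^ N
  have hFnear : ∀ (x : unitCube m) i, |F x i - ((1 - 2 * η) * (h x).1 i + η)| < η := by
    intro x i
    have h1 := abs_lt.mp (hP i x)
    have h2 : 0 ≤ x.1 i ^ N := pow_nonneg (x.2 i).1 N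
    have h3 : x.1 i ^ N ≤ 1 := pow_le_one₀ (x.2 i).1 (x.2 i).2
    rw [abs_lt]
    constructor <;> simp only [F] <;> nlinarith
  have hFmem : ∀ x : unitCube m, F x ∈ unitCube m := by
    intro x i
    have h1 := abs_lt.mp (hFnear x i)
    have h2 := (h x).2 i
    constructor <;> nlinarith [h2.1, h2.2]
  have hFcont : Continuous F := by
    refine continuous_pi fun i => ?_
    exact (MvPolynomial.continuous_eval (P i)).add (by fun_prop)
  let k : C(unitCube m, unitCube m) := ⟨fun x => ⟨F x, hFmem x⟩, by fun_prop⟩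
  have hfin : ∀ R : Fin m → MvPolynomial (Fin m) ℝ, (∀ i, (R i).totalDegree ≤ 1) →
      {x : unitCube m | ∀ i, F x i = MvPolynomial.eval x.1 (R i)}.Finite := by
    intro R hR
    have := MvPolynomial.finite_setOf_eval_add_pow_eq_zero (fun i => P i - R i)
      (half_pos hη).ne' (N := N) fun i => by
        have h1 := MvPolynomial.totalDegree_sub (P i) (R i)
        have h2 := hN i
        have h3 := hR i
        grind
    refine (this.preimage (Subtype.coe_injective.injOn (s := _))).subset fun x hx i => ?_
    have := hx i
    simp only [F] at this
    rw [map_sub]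
    linarith
  refine ⟨k, ?_, fun y => ?_, ?_⟩
  · rw [Metric.mem_ball, ContinuousMap.dist_lt_iff hε]
    intro x
    refine lt_of_le_of_lt ?_ hηε
    rw [Subtype.dist_eq, dist_pi_le_iff (by positivity)]
    intro i
    have h1 := abs_lt.mp (hFnear x i)
    have h2 := (h x).2 i
    change |F x i - (h x).1 i| ≤ _
    rw [abs_le]
    constructor <;> nlinarith [h2.1, h2.2]
  · refine (hfin (fun i => MvPolynomial.C (y.1 i)) (by simp)).subset fun x hx i => ?_
    simp only [MvPolynomial.eval_C]
    exact congrFun (congrArg Subtype.val hx) i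
  · refine (hfin (fun i => MvPolynomial.X i) (by simp)).subset fun x hx i => ?_
    simp only [MvPolynomial.eval_X]
    exact congrFun (congrArg Subtype.val hx) i

/-! ### Collapsing a small ball -/

/-- The scaling factor is nondecreasing in the norm, so two vectors with the same nonzero image have
equal factors. -/
theorem radial_collapse_fiber_subsingleton {E : Type*} [NormedAddCommGroup E] [NormedSpace ℝ E]
    {r : ℝ} (hr : 0 < r) {w : E} (hw : w ≠ 0) :
    {v : E | min 1 (max 0 (‖v‖ / r - 1)) • v = w}.Subsingleton := by
  intro v hv v' hv'
  simp only [Set.mem_ofPred_eq] at hv hv'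
  wlog hle : ‖v‖ ≤ ‖v'‖ generalizing v v'
  · exact (this hv' hv (le_of_not_ge hle)).symm
  have hpos : ∀ {v : E}, min 1 (max 0 (‖v‖ / r - 1)) • v = w →
      0 < min 1 (max 0 (‖v‖ / r - 1)) := by
    intro v hv
    refine lt_of_le_of_ne (le_min zero_le_one (le_max_left _ _)) fun h0 => hw ?_
    rw [← hv, ← h0, zero_smul]
  set c := min 1 (max 0 (‖v‖ / r - 1)) with hc
  set c' := min 1 (max 0 (‖v'‖ / r - 1)) with hc'
  have hc0 : 0 < c := hpos hv
  have hc0' : 0 < c' := hpos hv'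
  have hcc : c ≤ c' := by
    rw [hc, hc']
    gcongr
  have hn : c * ‖v‖ = c' * ‖v'‖ := by
    have := congrArg norm (hv.trans hv'.symm)
    rwa [norm_smul, norm_smul, Real.norm_of_nonneg hc0.le, Real.norm_of_nonneg hc0'.le] at this
  have hv0 : 0 < ‖v‖ := norm_pos_iff.mpr fun h => hw (by rw [← hv, h, smul_zero])
  have hceq : c = c' := by
    refine le_antisymm hcc ?_
    by_contra hlt
    push Not at hlt
    nlinarith
  rw [← hceq] at hv'
  exact smul_right_injective E hc0.ne' (hv.trans hv'.symm)

theorem unitCube.exists_collapse {m : ℕ} (p : unitCube m) {r : ℝ} (hr : 0 < r) :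
    ∃ φ : C(unitCube m, unitCube m), (∀ x, dist x p ≤ r → φ x = p) ∧
      (∀ x, 2 * r ≤ dist x p → φ x = x) ∧ (∀ x, dist (φ x) x ≤ 2 * r) ∧
      ∀ y, y ≠ p → (φ ⁻¹' {y}).Finite := by
  let c : (Fin m → ℝ) → ℝ := fun v => min 1 (max 0 (‖v‖ / r - 1))
  have hc0 : ∀ v, 0 ≤ c v := fun v => le_min zero_le_one (le_max_left _ _)
  have hc1 : ∀ v, c v ≤ 1 := fun v => min_le_left _ _
  let F : (Fin m → ℝ) → Fin m → ℝ := fun x => p.1 + c (x - p.1) • (x - p.1)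
  have hF : ∀ x : unitCube m, F x ∈ unitCube m := by
    intro x i
    have h0 := hc0 (x.1 - p.1)
    have h1 := hc1 (x.1 - p.1)
    have hx := x.2 i
    have hp := p.2 i
    simp only [F, Pi.add_apply, Pi.smul_apply, Pi.sub_apply, smul_eq_mul]
    constructor <;> nlinarith [hx.1, hx.2, hp.1, hp.2]
  have hcont : Continuous F := by
    simp only [F, c]
    fun_prop
  have hdist : ∀ x : unitCube m, dist x p = ‖x.1 - p.1‖ := fun x => by
    rw [Subtype.dist_eq, dist_eq_norm]
  have hfar : ∀ x : unitCube m, 2 * r ≤ dist x p → F x = x := by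
    intro x hx
    have h2 : 2 ≤ ‖x.1 - p.1‖ / r := by rwa [le_div_iff₀ hr, ← hdist]
    have : c (x.1 - p.1) = 1 := min_eq_left (le_max_of_le_right (by linarith))
    simp [F, this]
  refine ⟨⟨fun x => ⟨F x, hF x⟩, by fun_prop⟩, fun x hx => Subtype.ext ?_,
    fun x hx => Subtype.ext (hfar x hx), fun x => ?_, fun y hy => ?_⟩
  · have h1 : ‖x.1 - p.1‖ / r ≤ 1 := by rwa [div_le_one hr, ← hdist]
    have : c (x.1 - p.1) = 0 := by
      simp only [c]
      rw [max_eq_left (by linarith)]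
      simp
    simp [F, this]
  · rcases le_total (2 * r) (dist x p) with hx | hx
    · have : (⟨F x, hF x⟩ : unitCube m) = x := Subtype.ext (hfar x hx)
      change dist (⟨F x, hF x⟩ : unitCube m) x ≤ _
      rw [this, dist_self]
      positivity
    · refine le_trans ?_ hx
      rw [hdist]
      change dist (F x) x.1 ≤ _
      have : F x - x.1 = (c (x.1 - p.1) - 1) • (x.1 - p.1) := by
        simp only [F]
        module
      rw [dist_eq_norm, this, norm_smul]
      refine mul_le_of_le_one_left (norm_nonneg _) ?_
      rw [Real.norm_eq_abs, abs_le]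
      constructor <;> linarith [hc0 (x.1 - p.1), hc1 (x.1 - p.1)]
  · refine Set.Subsingleton.finite fun x hx x' hx' => Subtype.ext ?_
    have hy' : y.1 - p.1 ≠ 0 := sub_ne_zero.mpr (Subtype.coe_injective.ne hy)
    have key : ∀ z : unitCube m, (⟨F z, hF z⟩ : unitCube m) = y →
        c (z.1 - p.1) • (z.1 - p.1) = y.1 - p.1 := by
      intro z hz
      rw [← hz]
      simp [F]
    exact sub_left_injective
      (radial_collapse_fiber_subsingleton hr hy' (key x hx) (key x' hx'))

/-! ### Density in the cube -/

theorem unitCube.infinite_of_isOpen {m : ℕ} (hm : 1 ≤ m) {U : Set (unitCube m)} (hU : IsOpen U)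
    (hne : U.Nonempty) : U.Infinite := by
  obtain ⟨q, hq⟩ := hne
  have : Nontrivial (unitCube m) := by
    refine ⟨⟨0, fun i => by simp⟩, ⟨1, fun i => by simp⟩, fun h => ?_⟩
    simpa using congrFun (congrArg Subtype.val h) ⟨0, hm⟩
  have hconn : PreconnectedSpace (unitCube m) := by
    refine isPreconnected_iff_preconnectedSpace.mp (Convex.isPreconnected ?_)
    have : unitCube m = Set.pi Set.univ fun _ => Set.Icc (0 : ℝ) 1 := by
      ext x
      simp only [unitCube, Set.mem_ofPred_eq, Set.mem_pi, Set.mem_univ, true_imp_iff]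
    rw [this]
    exact convex_pi fun i _ => convex_Icc 0 1
  have : ConnectedSpace (unitCube m) := { toNonempty := ⟨q⟩ }
  exact infinite_of_mem_nhds q (hU.mem_nhds hq)

theorem unitCube.exists_near_not_exists_iterativeSquareRoot {m : ℕ} (hm : 1 ≤ m)
    (h : C(unitCube m, unitCube m)) {ε : ℝ} (hε : 0 < ε) :
    ∃ f ∈ Metric.ball h ε, ¬ ∃ g : unitCube m → unitCube m, IsIterativeSquareRoot g f := by
  obtain ⟨k, hk, hkfin, hkfix⟩ :=
    unitCube.exists_near_finite_fiber_finite_fixedPoints h (half_pos hε)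
  -- Otherwise `k ∘ k` maps the cube into the finite fixed-point set, and finite fibres would make
  -- the cube finite.
  obtain ⟨q, hq⟩ : ∃ q, k (k (k q)) ≠ k (k q) := by
    by_contra! H
    have huniv : (Set.univ : Set (unitCube m)).Finite := by
      refine (((hkfix.preimage' fun y _ => hkfin y).preimage' fun y _ => hkfin y)).subset
        fun q _ => H q
    exact unitCube.infinite_of_isOpen hm isOpen_univ ⟨⟨0, fun i => by simp⟩, trivial⟩ huniv
  set p := k q with hp
  have hkp : k p ≠ p := fun e => hq (by rw [e, e])
  have hqp : q ≠ p := fun e => hkp (by rw [← e, ← hp, ← e])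
  obtain ⟨δ, hδ, hkδ⟩ := Metric.uniformContinuous_iff.mp
    (CompactSpace.uniformContinuous_of_continuous k.continuous) (ε / 4) (by positivity)
  -- The bounds keep `k ∘ φ` close to `k` and make `φ` fix both `q` and `k p`.
  obtain ⟨r, hr, hr1, hr2, hr3⟩ : ∃ r : ℝ, 0 < r ∧ 2 * r < δ ∧ 2 * r < dist q p ∧
      2 * r < dist (k p) p := by
    have h2 := dist_pos.mpr hqp
    have h3 := dist_pos.mpr hkp
    refine ⟨min δ (min (dist q p) (dist (k p) p)) / 3, by positivity, ?_, ?_, ?_⟩ <;> grind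
  obtain ⟨φ, hφp, hφid, hφd, hφfin⟩ := unitCube.exists_collapse p hr
  refine ⟨k.comp φ, ?_, ?_⟩
  · have h1 : dist (k.comp φ) k ≤ ε / 4 := by
      rw [ContinuousMap.dist_le (by positivity)]
      exact fun x => (hkδ ((hφd x).trans_lt hr1)).le
    have h2 := dist_triangle (k.comp φ) k h
    rw [Metric.mem_ball] at hk ⊢
    linarith
  · refine not_exists_iterativeSquareRoot_of_infinite_fiber (a := k p) ?_ ?_ fun y hy => ?_
    · rw [ContinuousMap.comp_apply, hφid _ hr3.le]
      exact hq
    -- On `U`, `φ` is the identity and `k` lands in the collapsed ball, so `k '' U` lies in both the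
    -- range of `k ∘ φ` and its fibre over `k p`.
    · set U : Set (unitCube m) := {x | 2 * r < dist x p} ∩ {x | dist (k x) p < r} with hU
      have hUo : IsOpen U := (isOpen_lt (by fun_prop) (by fun_prop)).inter
        (isOpen_lt (by fun_prop) (by fun_prop))
      have hUinf := unitCube.infinite_of_isOpen hm hUo ⟨q, hr2, by simpa [← hp] using hr⟩
      have himage : (k '' U).Infinite := fun hf =>
        hUinf ((hf.preimage' fun y _ => hkfin y).subset (Set.subset_preimage_image k U))
      refine himage.mono ?_
      rintro _ ⟨x, ⟨hx1, hx2⟩, rfl⟩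
      refine ⟨?_, x, ?_⟩
      · simp only [Set.mem_preimage, ContinuousMap.comp_apply, Set.mem_singleton_iff]
        rw [hφp _ (le_of_lt hx2)]
      · rw [ContinuousMap.comp_apply, hφid x (le_of_lt hx1)]
    · rw [ContinuousMap.coe_comp, Set.preimage_comp]
      refine (hkfin y).preimage' fun z hz => hφfin z ?_
      rintro rfl
      exact hy (by simpa using hz.symm)

/-! ### Transfer to homeomorphic spaces -/

theorem IsIterativeSquareRoot.conj {X Y : Type*} (e : X ≃ Y) {g f : X → X}
    (hg : IsIterativeSquareRoot g f) : IsIterativeSquareRoot (e ∘ g ∘ e.symm) (e ∘ f ∘ e.symm) := by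
  subst hg
  funext y
  simp

/-- Conjugation is continuous for the compact-open topology, so `U` pulls back to an open set
containing a ball. On a compact metric space the supremum metric induces this topology, which covers
the metric case too. -/
theorem Homeomorph.exists_mem_not_exists_iterativeSquareRoot {m : ℕ} (hm : 1 ≤ m) {X : Type*}
    [TopologicalSpace X] (e : X ≃ₜ unitCube m) {U : Set C(X, X)} (hU : IsOpen U)
    (hne : U.Nonempty) : ∃ f ∈ U, ¬ ∃ g : X → X, IsIterativeSquareRoot g f := by
  obtain ⟨h, hh⟩ := hne
  let E : C(X, unitCube m) := e
  let E' : C(unitCube m, X) := e.symm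
  let Φ : C(unitCube m, unitCube m) → C(X, X) := fun k => E'.comp (k.comp E)
  have hΦ : Continuous Φ := (ContinuousMap.continuous_postcomp E').comp
    (ContinuousMap.continuous_precomp E)
  have hmem : E.comp (h.comp E') ∈ Φ ⁻¹' U := by
    have : Φ (E.comp (h.comp E')) = h := by
      ext x
      simp [Φ, E, E']
    simpa [this] using hh
  obtain ⟨ε, hε, hball⟩ := Metric.isOpen_iff.mp (hU.preimage hΦ) _ hmem
  obtain ⟨k, hk, hroot⟩ := unitCube.exists_near_not_exists_iterativeSquareRoot hm _ hε
  refine ⟨Φ k, hball hk, fun ⟨g, hg⟩ => hroot ⟨e ∘ g ∘ e.symm, ?_⟩⟩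
  · have := hg.conj e.toEquiv
    have hk' : e.toEquiv ∘ Φ k ∘ e.toEquiv.symm = k := by
      funext x
      simp [Φ, E, E']
    rwa [hk'] at this

theorem not_subset_iterateSet_two {X : Type*} [TopologicalSpace X] {U : Set C(X, X)}
    (hU : ∃ f ∈ U, ¬ ∃ g : X → X, IsIterativeSquareRoot g f) : ¬ U ⊆ iterateSet 2 X := by
  obtain ⟨f, hf, hroot⟩ := hU
  exact fun hsub => let ⟨g, hg⟩ := hsub hf; hroot ⟨g, hg⟩

/-- For the compact metric spaces below, `C(X, X)` carries the supremum metric; for a mere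
topological space it carries the compact-open topology. -/
theorem theorem3 (m : ℕ) (hm : 1 ≤ m) :
    -- the unit cube with the metric of the maximum norm
    ((∀ (h : C(unitCube m, unitCube m)) (ε : ℝ), 0 < ε →
        ∃ f ∈ Metric.ball h ε,
          ¬ ∃ g : unitCube m → unitCube m, IsIterativeSquareRoot g f) ∧
      (∀ (h : C(unitCube m, unitCube m)) (ε : ℝ), 0 < ε →
        ¬ Metric.ball h ε ⊆ iterateSet 2 (unitCube m))) ∧
    -- any topological space homeomorphic to the unit cube
    (∀ (X : Type*) [TopologicalSpace X], Nonempty (X ≃ₜ unitCube m) →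
      (∀ (h : C(X, X)) (U : Set C(X, X)), IsOpen U → h ∈ U →
        ∃ f ∈ U, ¬ ∃ g : X → X, IsIterativeSquareRoot g f) ∧
      (∀ U : Set C(X, X), IsOpen U → U.Nonempty → ¬ U ⊆ iterateSet 2 X)) ∧
    -- any (compact) metric space homeomorphic to the unit cube
    (∀ (X : Type*) [MetricSpace X] [CompactSpace X], Nonempty (X ≃ₜ unitCube m) →
      (∀ (h : C(X, X)) (ε : ℝ), 0 < ε →
        ∃ f ∈ Metric.ball h ε, ¬ ∃ g : X → X, IsIterativeSquareRoot g f) ∧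
      (∀ (h : C(X, X)) (ε : ℝ), 0 < ε → ¬ Metric.ball h ε ⊆ iterateSet 2 X)) := by
  refine ⟨⟨fun h ε hε => unitCube.exists_near_not_exists_iterativeSquareRoot hm h hε,
    fun h ε hε => not_subset_iterateSet_two
      (unitCube.exists_near_not_exists_iterativeSquareRoot hm h hε)⟩, ?_, ?_⟩
  · rintro X _ ⟨e⟩
    exact ⟨fun h U hU hh => e.exists_mem_not_exists_iterativeSquareRoot hm hU ⟨h, hh⟩,
      fun U hU hne => not_subset_iterateSet_two
        (e.exists_mem_not_exists_iterativeSquareRoot hm hU hne)⟩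
  · rintro X _ _ ⟨e⟩
    have key : ∀ (h : C(X, X)) (ε : ℝ), 0 < ε →
        ∃ f ∈ Metric.ball h ε, ¬ ∃ g : X → X, IsIterativeSquareRoot g f := fun h ε hε =>
      e.exists_mem_not_exists_iterativeSquareRoot hm Metric.isOpen_ball
        ⟨h, Metric.mem_ball_self hε⟩
    exact ⟨key, fun h ε hε => not_subset_iterateSet_two (key h ε hε)⟩
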